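/- Let $R>0$ and $\lambda_R=\frac{1+R}{2}+\sqrt{1+\left(\frac{1+R}{2}\right)^2}$. For irrational $t\in(0,1)$ let $t=[0;e_1(t),e_2(t),\dots]$ be its regular continued fraction expansion and let $d_n(t)$ be the denominator of its $n$-th convergent. Put $$M_R=\{x\in\mathbb C: |x|=1,\ |x+1|<R\},\qquad T_R=\Big\{t\in(0,1)\setminus\mathbb Q:\ \liminf_{n\to\infty}\frac{\lambda_R^{d_n(t)/2}}{e_{n+1}(t)}<\infty\Big\},$$ $$S_R=\{e^{2\pi i t}: t\in T_R\}\cap M_R .$$ Then $S_R$ is an uncountable set of measure zero (with respect to arc length on the unit circle), and for every $x\in S_R$ the Rogers–Ramanujan continued fraction $$K(x)=1+\cfrac{x}{1+\cfrac{x^2}{1+\cfrac{x^3}{1+\cdots}}}$$ diverges, that is, its approximants $P_n(x)/Q_n(x)$ have no limit in $\widehat{\mathbb C}=\mathbb C\cup\{\infty\}$ (an approximant is $\infty$ when $Q_n(x)=0$). Moreover, if $R<\sqrt5-1$ and $S$ is the Bowman–Mc Laughlin set of all $t\in(0,1)\setminus\mathbb Q$ with $e_{n+1}(t)\ge\phi^{d_n(t)}$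 for infinitely many $n$, where $\phi=\frac{1+\sqrt5}{2}$, then $\{e^{2\pi i t}:t\in S\}\cap M_R$ is a proper subset of $S_R$. -/

import Mathlib

open Filter Topology MeasureTheory

noncomputable section

namespace RogersRamanujan

/-- The continued fraction `1 + x/1 + x²/1 + x³/1 + ⋯` (partial numerators `xⁿ`, `n ≥ 1`,
partial denominators `1`). -/
def K (x : ℂ) : GenContFract ℂ where
  h := 1
  s := Stream'.Seq.ofStream fun n : ℕ => (⟨x ^ (n + 1), 1⟩ : GenContFract.Pair ℂ)

/-- The `n`-th approximant `Pₙ / Qₙ` of a complex continued fraction, as a point of the Riemann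
sphere `ℂ ∪ {∞}`; it is `∞` when `Qₙ = 0`. -/
def approximant (g : GenContFract ℂ) (n : ℕ) : OnePoint ℂ :=
  open Classical in
  if g.dens n = 0 then OnePoint.infty else ((g.nums n / g.dens n : ℂ) : OnePoint ℂ)

/-- A continued fraction converges if its approximants have a limit, finite or infinite. -/
def Converges (g : GenContFract ℂ) : Prop :=
  ∃ L : OnePoint ℂ, Tendsto (approximant g) atTop (𝓝 L)

/-- A continued fraction diverges if its approximants have no limit in the Riemann sphere. -/
def Diverges (g : GenContFract ℂ) : Prop :=
  ¬ Converges g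

/-- The partial quotient `eₙ₊₁(t)` of the regular continued fraction
`t = [e₀(t); e₁(t), e₂(t), …]`; for irrational `t` it exists for all `n`, so that the default
value is never used. -/
def partialQuotient (t : ℝ) (n : ℕ) : ℝ :=
  ((GenContFract.of t).partDens.get? n).getD 0

/-- The denominator `dₙ(t)` of the `n`-th convergent of the regular continued fraction of `t`. -/
def convergentDen (t : ℝ) (n : ℕ) : ℝ :=
  (GenContFract.of t).dens n

/-- `λ_R = (1 + R)/2 + √(1 + ((1 + R)/2)²)`. -/
def lam (R : ℝ) : ℝ :=
  (1 + R) / 2 + √(1 + ((1 + R) / 2) ^ 2)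

/-- The arc `{x : |x| = 1, |x + 1| < R}`. -/
def M (R : ℝ) : Set ℂ :=
  {x | ‖x‖ = 1 ∧ ‖x + 1‖ < R}

/-- The irrational `t ∈ (0, 1)` with `liminf λ_R ^ (dₙ(t) / 2) / eₙ₊₁(t) < ∞`. The lower limit
is taken in `[0, ∞]`. -/
def T (R : ℝ) : Set ℝ :=
  {t | t ∈ Set.Ioo 0 1 ∧ Irrational t ∧
    liminf (fun n : ℕ => ENNReal.ofReal
      (lam R ^ (convergentDen t n / 2) / partialQuotient t n)) atTop < ⊤}

/-- The point `e^{2πit}`. -/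
def expCircle (t : ℝ) : ℂ :=
  Complex.exp (2 * Real.pi * Complex.I * t)

/-- The set `S_R = {e^{2πit} : t ∈ T_R} ∩ M_R`. -/
def S (R : ℝ) : Set ℂ :=
  expCircle '' T R ∩ M R

/-- The set of irrational `t ∈ (0, 1)` with `eₙ₊₁(t) ≥ φ ^ dₙ(t)` for infinitely many `n`, where
`φ` is the golden ratio (Bowman and Mc Laughlin). -/
def bowmanMcLaughlin : Set ℝ :=
  {t | t ∈ Set.Ioo 0 1 ∧ Irrational t ∧
    ∃ᶠ n : ℕ in atTop, Real.goldenRatio ^ convergentDen t n ≤ partialQuotient t n}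

end RogersRamanujan

end

noncomputable section

namespace RogersRamanujan

/-! The numerators and denominators of `K x` solve one recurrence, `rrSeq x a`, with `a = 1` and `a
= 0`; index `n + 1` there is index `n` of the approximants. On the unit circle the determinant of
two consecutive approximants has modulus one. Hence, if numerators and denominators stay below a
fixed bound at infinitely many consecutive pairs of indices, there is no limit
(`diverges_of_frequently_norm_le`).

Such pairs come from roots of unity. At a primitive `m`-th root of unity, Schur's finite identities
write the solutions at `m` and `m + 1` through Gaussian binomials, nearly all of which vanish, so
the values are at most 8 whatever `m` is (`norm_rrSeq_le_of_isPrimitiveRoot`). Passing to a nearby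
`x` in the arc costs at most `3 |x - y| n² r ^ n` with `r = √(lam R)` (`norm_rrSeq_sub_le`). If `y`
comes from the convergent `c / d` of `t`, then `|x - y|` is at most `2π / (e d²)`, where `e` is the
next partial quotient. The definition of `T R` says that `r ^ d / e` is bounded infinitely often, so
the cost is bounded there.

The set is null because its parameters are approximable to order 3. It is uncountable because
partial quotients may be prescribed freely above the threshold. The inclusion of the Bowman–Mc
Laughlin set is proper because `√(lam R) < φ`: partial quotients of size about `√(lam R) ^ d` are
enough for `T R` but fall below `φ ^ d`. -/

/-- The Gaussian binomial coefficient `[n choose k]_q`, with `k` an arbitrary integer. -/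
def gaussBinom {F : Type*} [Field F] (q : F) : ℕ → ℤ → F
  | 0, k => if k = 0 then 1 else 0
  | n + 1, k => gaussBinom q n (k - 1) + q ^ k * gaussBinom q n k

/-! ### Gaussian binomials and their vanishing at roots of unity -/

section GaussBinom

variable {F : Type*} [Field F] {q : F}

theorem gaussBinom_succ (q : F) (n : ℕ) (k : ℤ) :
    gaussBinom q (n + 1) k = gaussBinom q n (k - 1) + q ^ k * gaussBinom q n k := rfl

theorem gaussBinom_of_neg (q : F) (n : ℕ) {k : ℤ} (hk : k < 0) : gaussBinom q n k = 0 := by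
  induction n generalizing k with
  | zero => simp [gaussBinom, hk.ne]
  | succ n ih => rw [gaussBinom_succ, ih hk, ih (by omega)]; simp

theorem gaussBinom_of_lt (q : F) (n : ℕ) {k : ℤ} (hk : (n : ℤ) < k) : gaussBinom q n k = 0 := by
  induction n generalizing k with
  | zero =>
    have : k ≠ 0 := by push_cast at hk; omega
    simp [gaussBinom, this]
  | succ n ih =>
    push_cast at hk
    rw [gaussBinom_succ, ih (by omega), ih (by omega)]; simp

theorem gaussBinom_zero_right (q : F) (n : ℕ) : gaussBinom q n 0 = 1 := by
  induction n with
  | zero => simp [gaussBinom]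
  | succ n ih => rw [gaussBinom_succ, ih, gaussBinom_of_neg q n (by norm_num)]; simp

theorem gaussBinom_self (q : F) (n : ℕ) : gaussBinom q n n = 1 := by
  induction n with
  | zero => simp [gaussBinom]
  | succ n ih =>
    rw [gaussBinom_succ, gaussBinom_of_lt q n (k := ((n + 1 : ℕ) : ℤ)) (by push_cast; omega)]
    simpa using ih

theorem gaussBinom_succ' (hq : q ≠ 0) (n : ℕ) (k : ℤ) :
    gaussBinom q (n + 1) k =
      q ^ ((n : ℤ) + 1 - k) * gaussBinom q n (k - 1) + gaussBinom q n k := by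
  induction n generalizing k with
  | zero =>
    rw [gaussBinom_succ]
    by_cases h0 : k = 0
    · subst h0; simp [gaussBinom]
    · by_cases h1 : k = 1
      · subst h1; simp [gaussBinom]
      · have : k - 1 ≠ 0 := by omega
        simp [gaussBinom, h0, this]
  | succ n ih =>
    have h1 := ih k
    have h2 := ih (k - 1)
    have h3 := gaussBinom_succ q n k
    have h4 := gaussBinom_succ q n (k - 1)
    rw [gaussBinom_succ q (n + 1) k]
    have e1 : q ^ k * q ^ ((n : ℤ) + 1 - k) = q ^ ((n : ℤ) + 1) := by
      rw [← zpow_add₀ hq]; congr 1; ring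
    have e2 : q ^ (((n + 1 : ℕ) : ℤ) + 1 - k) * q ^ (k - 1) = q ^ ((n : ℤ) + 1) := by
      rw [← zpow_add₀ hq]; congr 1; push_cast; ring
    have e3 : (n : ℤ) + 1 - (k - 1) = ((n + 1 : ℕ) : ℤ) + 1 - k := by push_cast; ring
    rw [e3] at h2
    linear_combination h2 + q ^ k * h1 - q ^ (((n + 1 : ℕ) : ℤ) + 1 - k) * h4 - h3 +
      (e1 - e2) * gaussBinom q n (k - 1)

/-- Eliminate `gaussBinom q n k` between the two Pascal rules. When `q ^ (n + 1) = 1` the right side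
is zero, which forces the vanishing below. -/
theorem one_sub_zpow_mul_gaussBinom_succ (hq : q ≠ 0) (n : ℕ) (k : ℤ) :
    (1 - q ^ k) * gaussBinom q (n + 1) k = (1 - q ^ (n + 1)) * gaussBinom q n (k - 1) := by
  have e1 : q ^ k * q ^ ((n : ℤ) + 1 - k) = q ^ (n + 1) := by
    rw [← zpow_add₀ hq, ← zpow_natCast]; congr 1; push_cast; ring
  linear_combination gaussBinom_succ q n k - q ^ k * gaussBinom_succ' hq n k -
    e1 * gaussBinom q n (k - 1)

theorem gaussBinom_eq_zero_of_isPrimitiveRoot {m : ℕ} (hq : IsPrimitiveRoot q m) (hm : m ≠ 0)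
    {k : ℤ} (h0 : k ≠ 0) (h1 : k ≠ m) : gaussBinom q m k = 0 := by
  rcases lt_or_ge k 0 with hk | hk
  · exact gaussBinom_of_neg q m hk
  rcases lt_or_ge (m : ℤ) k with hk' | hk'
  · exact gaussBinom_of_lt q m hk'
  obtain ⟨n, rfl⟩ := Nat.exists_eq_succ_of_ne_zero hm
  have h := one_sub_zpow_mul_gaussBinom_succ (hq.ne_zero hm) n k
  rw [hq.pow_eq_one, sub_self, zero_mul] at h
  refine (mul_eq_zero.1 h).resolve_left fun h2 => ?_
  have h3 := (hq.zpow_eq_one_iff_dvd k).1 (sub_eq_zero.1 h2).symm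
  have := Int.le_of_dvd (by omega) h3
  omega

end GaussBinom

/-! ### Schur's finite identities -/

/-- The solution of `uₙ₊₂ = uₙ₊₁ + xⁿ⁺¹ uₙ` with `u₀ = a` and `u₁ = 1`. -/
def rrSeq (x a : ℂ) : ℕ → ℂ
  | 0 => a
  | 1 => 1
  | n + 2 => rrSeq x a (n + 1) + x ^ (n + 1) * rrSeq x a n

/-- The summand of the finite Schur identity for `u₂ₙ`. -/
def schurEven (q : ℂ) (s : ℤ) (N : ℕ) (μ : ℤ) : ℂ :=
  q ^ (10 * μ ^ 2 + (1 - 4 * s) * μ) * gaussBinom q (2 * N) (N + s - 5 * μ) -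
    q ^ (10 * μ ^ 2 + (11 - 4 * s) * μ + 3 - 2 * s) * gaussBinom q (2 * N) (N + s - 3 - 5 * μ)

/-- The summand of the finite Schur identity for `u₂ₙ₊₁`. -/
def schurOdd (q : ℂ) (s : ℤ) (N : ℕ) (μ : ℤ) : ℂ :=
  q ^ (10 * μ ^ 2 + (1 - 4 * s) * μ) * gaussBinom q (2 * N + 1) (N + s - 5 * μ) -
    q ^ (10 * μ ^ 2 + (11 - 4 * s) * μ + 3 - 2 * s) *
      gaussBinom q (2 * N + 1) (N + s - 2 - 5 * μ)

theorem finite_support_mul_gaussBinom (q : ℂ) (n : ℕ) (c : ℤ → ℂ) (k : ℤ) :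
    (Function.support fun μ : ℤ => c μ * gaussBinom q n (k - 5 * μ)).Finite := by
  refine (Set.finite_Icc (-|k| - n) (|k| + n)).subset fun μ hμ => ?_
  have h : gaussBinom q n (k - 5 * μ) ≠ 0 := right_ne_zero_of_mul hμ
  have h1 : ¬ k - 5 * μ < 0 := fun h' => h (gaussBinom_of_neg q n h')
  have h2 : ¬ (n : ℤ) < k - 5 * μ := fun h' => h (gaussBinom_of_lt q n h')
  have := abs_le.1 (le_refl |k|)
  constructor <;> omega

theorem finite_support_schurEven (q : ℂ) (s : ℤ) (N : ℕ) :
    (Function.support (schurEven q s N)).Finite :=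
  ((finite_support_mul_gaussBinom q _ _ _).union (finite_support_mul_gaussBinom q _ _ _)).subset
    (Function.support_sub _ _)

theorem finite_support_schurOdd (q : ℂ) (s : ℤ) (N : ℕ) :
    (Function.support (schurOdd q s N)).Finite :=
  ((finite_support_mul_gaussBinom q _ _ _).union (finite_support_mul_gaussBinom q _ _ _)).subset
    (Function.support_sub _ _)

/-- Here the recurrence holds summand by summand: each Pascal rule is applied so that the leftover
terms of the two products cancel. -/
theorem schurOdd_succ {q : ℂ} (hq : q ≠ 0) (s : ℤ) (N : ℕ) (μ : ℤ) :
    schurOdd q s (N + 1) μ =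
      schurEven q s (N + 1) μ + q ^ (2 * N + 2) * schurOdd q s N μ := by
  unfold schurOdd schurEven
  have a1 := gaussBinom_succ' hq (2 * (N + 1)) ((N + 1 : ℕ) + s - 5 * μ)
  have a2 := gaussBinom_succ q (2 * (N + 1)) ((N + 1 : ℕ) + s - 2 - 5 * μ)
  have a3 := gaussBinom_succ q (2 * N + 1) ((N : ℤ) + s - 5 * μ)
  have a4 := gaussBinom_succ' hq (2 * N + 1) ((N : ℤ) + s - 1 - 5 * μ)
  rw [show 2 * N + 1 + 1 = 2 * (N + 1) by ring] at a3 a4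
  have k1 : ((N + 1 : ℕ) : ℤ) + s - 5 * μ - 1 = N + s - 5 * μ := by push_cast; ring
  have k2 : ((N + 1 : ℕ) : ℤ) + s - 2 - 5 * μ - 1 = (N + 1 : ℕ) + s - 3 - 5 * μ := by ring
  have k3 : ((N + 1 : ℕ) : ℤ) + s - 2 - 5 * μ = N + s - 1 - 5 * μ := by push_cast; ring
  have k4 : (N : ℤ) + s - 5 * μ - 1 = N + s - 1 - 5 * μ := by ring
  have k5 : (N : ℤ) + s - 1 - 5 * μ - 1 = N + s - 2 - 5 * μ := by ring
  rw [k1] at a1; rw [k2, k3] at a2; rw [k4] at a3; rw [k5] at a4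
  rw [k3, a1, a2, a3, a4]
  have p : ∀ i j : ℤ, q ^ i * q ^ j = q ^ (i + j) := fun i j => (zpow_add₀ hq i j).symm
  have e0 : q ^ (2 * N + 2) = q ^ (2 * (N : ℤ) + 2) := by exact_mod_cast rfl
  simp only [mul_add, e0, mul_sub, ← mul_assoc, p]
  push_cast
  ring_nf

/-- Here the recurrence holds only up to a difference `f μ - f (μ + 1)`, which disappears on summing
over all integers `μ`. -/
theorem schurEven_succ {q : ℂ} (hq : q ≠ 0) (s : ℤ) (N : ℕ) (μ : ℤ) :
    schurEven q s (N + 1) μ = schurOdd q s N μ + q ^ (2 * N + 1) * schurEven q s N μ +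
      (q ^ (10 * μ ^ 2 + (-4 - 4 * s) * μ + N + 1 + s) *
          gaussBinom q (2 * N) (N + 1 + s - 5 * μ) -
        q ^ (10 * (μ + 1) ^ 2 + (-4 - 4 * s) * (μ + 1) + N + 1 + s) *
          gaussBinom q (2 * N) (N + 1 + s - 5 * (μ + 1))) := by
  unfold schurOdd schurEven
  have a1 := gaussBinom_succ q (2 * N + 1) ((N + 1 : ℕ) + s - 5 * μ)
  have a2 := gaussBinom_succ' hq (2 * N + 1) ((N + 1 : ℕ) + s - 3 - 5 * μ)
  have a3 := gaussBinom_succ' hq (2 * N) ((N : ℤ) + 1 + s - 5 * μ)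
  have a4 := gaussBinom_succ q (2 * N) ((N : ℤ) + s - 3 - 5 * μ)
  have k1 : ((N + 1 : ℕ) : ℤ) + s - 5 * μ - 1 = N + s - 5 * μ := by push_cast; ring
  have k1' : ((N + 1 : ℕ) : ℤ) + s - 5 * μ = N + 1 + s - 5 * μ := by push_cast; ring
  have k2 : ((N + 1 : ℕ) : ℤ) + s - 3 - 5 * μ - 1 = N + s - 3 - 5 * μ := by push_cast; ring
  have k3 : ((N + 1 : ℕ) : ℤ) + s - 3 - 5 * μ = N + s - 2 - 5 * μ := by push_cast; ring
  have k4 : (N : ℤ) + 1 + s - 5 * μ - 1 = N + s - 5 * μ := by ring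
  have k5 : (N : ℤ) + s - 3 - 5 * μ - 1 = N + 1 + s - 5 * (μ + 1) := by ring
  rw [k1, k1'] at a1; rw [k2, k3] at a2; rw [k4] at a3; rw [k5] at a4
  rw [show 2 * (N + 1) = 2 * N + 1 + 1 by ring, k1', k3, a1, a2, a3, a4]
  have p : ∀ i j : ℤ, q ^ i * q ^ j = q ^ (i + j) := fun i j => (zpow_add₀ hq i j).symm
  have e0 : q ^ (2 * N + 1) = q ^ (2 * (N : ℤ) + 1) := by exact_mod_cast rfl
  simp only [mul_add, e0, mul_sub, ← mul_assoc, p]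
  push_cast
  ring_nf

theorem finsum_sub_comp_add_one {f : ℤ → ℂ} (hf : (Function.support f).Finite) :
    ∑ᶠ μ, (f μ - f (μ + 1)) = 0 := by
  have h : (Function.support fun μ => f (μ + 1)).Finite :=
    hf.preimage (f := fun μ : ℤ => μ + 1) (add_left_injective 1).injOn
  rw [finsum_sub_distrib hf h, sub_eq_zero]
  exact (finsum_comp_equiv (Equiv.addRight (1 : ℤ)) (f := f)).symm

/-- The finite form, due to Schur, of the Rogers–Ramanujan identities. -/
theorem rrSeq_eq_finsum {q : ℂ} (hq : q ≠ 0) {s : ℤ} (hs : s = 0 ∨ s = 1) (N : ℕ) :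
    rrSeq q (1 - s) (2 * N) = ∑ᶠ μ, schurEven q s N μ ∧
      rrSeq q (1 - s) (2 * N + 1) = ∑ᶠ μ, schurOdd q s N μ := by
  induction N with
  | zero =>
    have z1 : ∀ k : ℤ, k ≠ 0 → gaussBinom q 0 k = 0 := fun k hk => by simp [gaussBinom, hk]
    have z2 : ∀ k : ℤ, k < 0 ∨ 1 < k → gaussBinom q 1 k = 0 := fun k hk => by
      rcases hk with hk | hk
      · exact gaussBinom_of_neg q 1 hk
      · exact gaussBinom_of_lt q 1 (by exact_mod_cast hk)
    constructor
    · rw [finsum_eq_single _ 0]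
      · rcases hs with rfl | rfl <;>
          simp [schurEven, rrSeq, gaussBinom]
      · intro μ hμ
        simp only [schurEven]
        rw [z1, z1] <;> [simp; (push_cast; omega); (push_cast; omega)]
    · rw [finsum_eq_single _ 0]
      · rcases hs with rfl | rfl <;>
          simp [schurOdd, rrSeq, gaussBinom]
      · intro μ hμ
        simp only [schurOdd]
        rw [mul_zero, zero_add, z2, z2] <;> [simp; (push_cast; omega); (push_cast; omega)]
  | succ N ih =>
    have hE := finite_support_schurEven q s
    have hO := finite_support_schurOdd q s
    have e1 : rrSeq q (1 - s) (2 * (N + 1)) = ∑ᶠ μ, schurEven q s (N + 1) μ := by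
      rw [finsum_congr (schurEven_succ hq s N)]
      have hm : (Function.support fun μ => q ^ (2 * N + 1) * schurEven q s N μ).Finite :=
        (hE N).subset (Function.support_mul_subset_right _ _)
      have hZ := finite_support_mul_gaussBinom q (2 * N)
        (fun μ => q ^ (10 * μ ^ 2 + (-4 - 4 * s) * μ + N + 1 + s)) (N + 1 + s)
      rw [finsum_add_distrib, finsum_add_distrib (hO N) hm, ← mul_finsum' _ _ (hE N), ← ih.1, ← ih.2,
        finsum_sub_comp_add_one hZ, add_zero]
      · rfl
      · exact ((hO N).union hm).subset (Function.support_add _ _)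
      · refine (hZ.union (hZ.preimage (f := fun μ : ℤ => μ + 1)
          (add_left_injective 1).injOn)).subset (Function.support_sub _ _)
    refine ⟨e1, ?_⟩
    have hm : (Function.support fun μ => q ^ (2 * N + 2) * schurOdd q s N μ).Finite :=
      (hO N).subset (Function.support_mul_subset_right _ _)
    rw [finsum_congr (schurOdd_succ hq s N), finsum_add_distrib (hE _) hm,
      ← mul_finsum' _ _ (hO N), ← e1, ← ih.2]
    rfl

/-! ### Uniform bounds at roots of unity -/

theorem norm_gaussBinom_le_one {q : ℂ} {m : ℕ} (hq : IsPrimitiveRoot q m) (hm : m ≠ 0) (k : ℤ) :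
    ‖gaussBinom q m k‖ ≤ 1 := by
  by_cases h0 : k = 0
  · simp [h0, gaussBinom_zero_right]
  by_cases h1 : k = m
  · simp [h1, gaussBinom_self]
  simp [gaussBinom_eq_zero_of_isPrimitiveRoot hq hm h0 h1]

/-- Only lower indices `0` and `m` contribute, and each is hit by at most one `μ`. -/
theorem norm_finsum_mul_gaussBinom_le {q : ℂ} {m : ℕ} (hq : IsPrimitiveRoot q m) (hm : m ≠ 0)
    (c : ℤ → ℂ) (hc : ∀ μ, ‖c μ‖ = 1) (k : ℤ) :
    ‖∑ᶠ μ : ℤ, c μ * gaussBinom q m (k - 5 * μ)‖ ≤ 2 := by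
  have hinj : Function.Injective fun μ : ℤ => k - 5 * μ := fun a b h => by
    simp only at h; omega
  set S : Finset ℤ := ({0, (m : ℤ)} : Finset ℤ).preimage (fun μ : ℤ => k - 5 * μ) hinj.injOn
  have hS : S.card ≤ 2 := (Finset.card_le_card_of_injOn _ (fun μ hμ => Finset.mem_preimage.1 hμ)
    hinj.injOn).trans Finset.card_le_two
  rw [finsum_eq_sum_of_support_subset (s := S)]
  · refine (norm_sum_le_of_le S (n := fun _ => (1 : ℝ)) fun μ _ => ?_).trans ?_
    · rw [norm_mul, hc, one_mul]
      exact norm_gaussBinom_le_one hq hm _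
    · simpa using (by exact_mod_cast hS : (S.card : ℝ) ≤ 2)
  · intro μ hμ
    have h : gaussBinom q m (k - 5 * μ) ≠ 0 := right_ne_zero_of_mul hμ
    simp only [S, Finset.coe_preimage, Set.mem_preimage, Finset.coe_insert,
      Finset.coe_singleton, Set.mem_insert_iff, Set.mem_singleton_iff]
    by_contra! h'
    exact h (gaussBinom_eq_zero_of_isPrimitiveRoot hq hm h'.1 h'.2)

/-- Pascal's rule splits the sum into two sums of the previous kind, since powers of `q` have
modulus one. -/
theorem norm_finsum_mul_gaussBinom_succ_le {q : ℂ} {m : ℕ} (hq : IsPrimitiveRoot q m)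
    (hm : m ≠ 0) (c : ℤ → ℂ) (hc : ∀ μ, ‖c μ‖ = 1) (k : ℤ) :
    ‖∑ᶠ μ : ℤ, c μ * gaussBinom q (m + 1) (k - 5 * μ)‖ ≤ 4 := by
  have e : ∀ μ, c μ * gaussBinom q (m + 1) (k - 5 * μ) =
      c μ * gaussBinom q m (k - 1 - 5 * μ) +
        (c μ * q ^ (k - 5 * μ)) * gaussBinom q m (k - 5 * μ) := fun μ => by
    rw [gaussBinom_succ, show k - 5 * μ - 1 = k - 1 - 5 * μ by ring]; ring
  rw [finsum_congr e, finsum_add_distrib (finite_support_mul_gaussBinom q m _ _)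
    (finite_support_mul_gaussBinom q m (fun μ => c μ * q ^ (k - 5 * μ)) _)]
  refine (norm_add_le_of_le (norm_finsum_mul_gaussBinom_le hq hm c hc _)
    (norm_finsum_mul_gaussBinom_le hq hm _ (fun μ => ?_) k)).trans (by norm_num)
  rw [norm_mul, hc, norm_zpow, hq.norm'_eq_one hm]; simp

/-- At a primitive `m`-th root of unity, the solutions are bounded at the end of a period by an
absolute constant. -/
theorem norm_rrSeq_le_of_isPrimitiveRoot {q : ℂ} {m : ℕ} (hq : IsPrimitiveRoot q m) (hm : m ≠ 0)
    {a : ℂ} (ha : a = 0 ∨ a = 1) : ‖rrSeq q a m‖ ≤ 8 ∧ ‖rrSeq q a (m + 1)‖ ≤ 8 := by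
  have hq0 := hq.ne_zero hm
  have hn : ∀ e : ℤ → ℤ, ∀ μ, ‖q ^ e μ‖ = 1 := fun e μ => by
    rw [norm_zpow, hq.norm'_eq_one hm, one_zpow]
  obtain ⟨s, hs, rfl⟩ : ∃ s : ℤ, (s = 0 ∨ s = 1) ∧ 1 - (s : ℂ) = a := by
    rcases ha with rfl | rfl
    · exact ⟨1, by simp⟩
    · exact ⟨0, by simp⟩
  have key : ∀ (n : ℕ) (e₁ e₂ : ℤ → ℤ) (k₁ k₂ : ℤ), n = m ∨ n = m + 1 →
      ‖∑ᶠ μ : ℤ, (q ^ e₁ μ * gaussBinom q n (k₁ - 5 * μ) -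
        q ^ e₂ μ * gaussBinom q n (k₂ - 5 * μ))‖ ≤ 8 := by
    intro n e₁ e₂ k₁ k₂ hn'
    have h4 : ∀ (e : ℤ → ℤ) k,
        ‖∑ᶠ μ : ℤ, q ^ e μ * gaussBinom q n (k - 5 * μ)‖ ≤ 4 := by
      intro e k
      rcases hn' with rfl | rfl
      · exact (norm_finsum_mul_gaussBinom_le hq hm _ (hn e) k).trans (by norm_num)
      · exact norm_finsum_mul_gaussBinom_succ_le hq hm _ (hn e) k
    rw [finsum_sub_distrib (finite_support_mul_gaussBinom q n (fun μ => q ^ e₁ μ) k₁)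
      (finite_support_mul_gaussBinom q n (fun μ => q ^ e₂ μ) k₂)]
    exact (norm_sub_le_of_le (h4 e₁ k₁) (h4 e₂ k₂)).trans (by norm_num)
  have fin : ∀ n : ℕ, n = m ∨ n = m + 1 → ‖rrSeq q (1 - s) n‖ ≤ 8 := by
    intro n hn'
    rcases Nat.even_or_odd' n with ⟨N, rfl | rfl⟩
    · rw [(rrSeq_eq_finsum hq0 hs N).1]
      exact key _ _ _ _ _ hn'
    · rw [(rrSeq_eq_finsum hq0 hs N).2]
      exact key _ _ _ _ _ hn'
  exact ⟨fin m (.inl rfl), fin (m + 1) (.inr rfl)⟩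

/-! ### Determinant, growth and perturbation on the unit circle -/

theorem rrSeq_add_two (x a : ℂ) (n : ℕ) :
    rrSeq x a (n + 2) = rrSeq x a (n + 1) + x ^ (n + 1) * rrSeq x a n := rfl

theorem norm_det_rrSeq {x : ℂ} (hx : ‖x‖ = 1) (n : ℕ) :
    ‖rrSeq x 1 (n + 1) * rrSeq x 0 n - rrSeq x 1 n * rrSeq x 0 (n + 1)‖ = 1 := by
  induction n with
  | zero => simp [rrSeq]
  | succ n ih =>
    have e : rrSeq x 1 (n + 1 + 1) * rrSeq x 0 (n + 1) - rrSeq x 1 (n + 1) * rrSeq x 0 (n + 1 + 1) =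
        -x ^ (n + 1) *
          (rrSeq x 1 (n + 1) * rrSeq x 0 n - rrSeq x 1 n * rrSeq x 0 (n + 1)) := by
      rw [rrSeq_add_two, rrSeq_add_two]; ring
    rw [e, norm_mul, ih, norm_neg, norm_pow, hx]; simp

theorem norm_pow_sub_pow_le {x y : ℂ} (hx : ‖x‖ = 1) (hy : ‖y‖ = 1) (n : ℕ) :
    ‖x ^ n - y ^ n‖ ≤ n * ‖x - y‖ := by
  induction n with
  | zero => simp
  | succ n ih =>
    have e : x ^ (n + 1) - y ^ (n + 1) = x * (x ^ n - y ^ n) + (x - y) * y ^ n := by ring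
    rw [e]
    refine (norm_add_le _ _).trans ?_
    rw [norm_mul, norm_mul, hx, norm_pow, hy, one_pow]
    push_cast
    linarith

section Growth

variable {R r : ℝ}

/-- This is the coefficient of the two-step recurrence, and the place where closeness of `x` to `-1`
lowers the growth rate. -/
theorem norm_one_add_pow_add_pow_succ_le {x : ℂ} (hx : ‖x‖ = 1) (hxR : ‖x + 1‖ ≤ R) (n : ℕ) :
    ‖1 + x ^ n + x ^ (n + 1)‖ ≤ 1 + R := by
  have e : 1 + x ^ n + x ^ (n + 1) = 1 + x ^ n * (x + 1) := by ring
  rw [e]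
  refine (norm_add_le _ _).trans ?_
  rw [norm_mul, norm_pow, hx]
  simpa using hxR

theorem norm_rrSeq_le {x a : ℂ} (hx : ‖x‖ = 1) (hxR : ‖x + 1‖ ≤ R) (ha : ‖a‖ ≤ 1)
    (hr : 1 ≤ r) (hrR : r ^ 4 = (1 + R) * r ^ 2 + 1) (n : ℕ) :
    ‖rrSeq x a n‖ ≤ 3 * r ^ n := by
  have hp : ∀ k, 1 ≤ r ^ k := fun k => one_le_pow₀ hr
  induction n using Nat.strong_induction_on with
  | _ n ih =>
  match n with
  | 0 => simp only [rrSeq, pow_zero]; linarith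
  | 1 => simp only [rrSeq, norm_one]; linarith [hp 1]
  | 2 =>
    have : ‖(1 : ℂ) + x * a‖ ≤ 2 := by
      refine (norm_add_le _ _).trans ?_
      rw [norm_mul, hx, norm_one]; linarith
    simp only [rrSeq, zero_add, pow_one]
    linarith [hp 2]
  | 3 =>
    have : ‖(1 : ℂ) + x * a + x ^ 2‖ ≤ 3 := by
      refine (norm_add₃_le).trans ?_
      rw [norm_mul, norm_pow, hx, norm_one]; linarith
    simp only [rrSeq, zero_add, pow_one, mul_one]
    norm_num
    linarith [hp 3]
  | n + 4 =>
    -- Eliminating the odd-offset terms gives a recurrence in steps of two, whose majorant has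
    -- characteristic equation `r ^ 4 = (1 + R) * r ^ 2 + 1`.
    have e : rrSeq x a (n + 4) = (1 + x ^ (n + 2) + x ^ (n + 2 + 1)) * rrSeq x a (n + 2) -
        x ^ (2 * n + 3) * rrSeq x a n := by
      rw [rrSeq_add_two x a (n + 2), rrSeq_add_two x a (n + 1), rrSeq_add_two x a n]; ring
    have hR := norm_one_add_pow_add_pow_succ_le hx hxR (n + 2)
    have hR0 : 0 ≤ 1 + R := (norm_nonneg _).trans hR
    rw [e]
    refine (norm_sub_le _ _).trans ?_
    rw [norm_mul, norm_mul, norm_pow x, hx, one_pow, one_mul]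
    calc _ ≤ (1 + R) * (3 * r ^ (n + 2)) + 3 * r ^ n :=
          add_le_add (mul_le_mul hR (ih _ (by omega)) (norm_nonneg _) hR0) (ih _ (by omega))
      _ = 3 * r ^ n * ((1 + R) * r ^ 2 + 1) := by ring
      _ = 3 * r ^ (n + 4) := by rw [← hrR]; ring

theorem norm_rrSeq_sub_le {x y a : ℂ} (hx : ‖x‖ = 1) (hxR : ‖x + 1‖ ≤ R) (hy : ‖y‖ = 1)
    (hyR : ‖y + 1‖ ≤ R) (ha : ‖a‖ ≤ 1) (hr : 1 ≤ r) (hrR : r ^ 4 = (1 + R) * r ^ 2 + 1) (n : ℕ) :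
    ‖rrSeq x a n - rrSeq y a n‖ ≤ 3 * ‖x - y‖ * n ^ 2 * r ^ n := by
  have hp : ∀ k, 1 ≤ r ^ k := fun k => one_le_pow₀ hr
  have hδ := norm_nonneg (x - y)
  induction n using Nat.strong_induction_on with
  | _ n ih =>
  match n with
  | 0 => simp [rrSeq]
  | 1 => simp only [rrSeq, sub_self, norm_zero]; have := hp 1; positivity
  | 2 =>
    have : ‖rrSeq x a 2 - rrSeq y a 2‖ ≤ ‖x - y‖ := by
      have e : rrSeq x a 2 - rrSeq y a 2 = (x - y) * a := by simp only [rrSeq]; ring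
      rw [e, norm_mul]; nlinarith
    refine this.trans ?_
    push_cast
    nlinarith [mul_nonneg hδ (sub_nonneg.2 (hp 2))]
  | 3 =>
    have : ‖rrSeq x a 3 - rrSeq y a 3‖ ≤ 3 * ‖x - y‖ := by
      have e : rrSeq x a 3 - rrSeq y a 3 = (x - y) * a + (x ^ 2 - y ^ 2) := by
        simp only [rrSeq]; ring
      rw [e]
      refine (norm_add_le _ _).trans ?_
      have := norm_pow_sub_pow_le hx hy 2
      push_cast at this
      rw [norm_mul]; nlinarith
    refine this.trans ?_
    push_cast
    nlinarith [mul_nonneg hδ (sub_nonneg.2 (hp 3))]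
  | n + 4 =>
    have hf : ∀ k, k ≤ n + 2 → ‖(x ^ (k + 1) - y ^ (k + 1)) * rrSeq y a k‖ ≤
        (n + 3) * ‖x - y‖ * (3 * r ^ (n + 4)) := by
      intro k hk
      rw [norm_mul]
      have h1 := norm_pow_sub_pow_le hx hy (k + 1)
      have h2 := norm_rrSeq_le hy hyR ha hr hrR k
      have h3 : r ^ k ≤ r ^ (n + 4) := pow_le_pow_right₀ hr (by omega)
      have h4 : ((k + 1 : ℕ) : ℝ) ≤ n + 3 := by exact_mod_cast (by omega : k + 1 ≤ n + 3)
      exact mul_le_mul (h1.trans (mul_le_mul_of_nonneg_right h4 hδ)) (h2.trans (by linarith))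
        (norm_nonneg _) (by positivity)
    -- The difference obeys the same two-step recurrence with three source terms, each carrying a
    -- factor `x ^ j - y ^ j`.
    have e : rrSeq x a (n + 4) - rrSeq y a (n + 4) =
        (1 + x ^ (n + 2) + x ^ (n + 2 + 1)) * (rrSeq x a (n + 2) - rrSeq y a (n + 2)) -
        x ^ (2 * n + 3) * (rrSeq x a n - rrSeq y a n) +
        ((x ^ (n + 2 + 1) - y ^ (n + 2 + 1)) * rrSeq y a (n + 2) +
        (x ^ (n + 1 + 1) - y ^ (n + 1 + 1)) * rrSeq y a (n + 1) -
        x ^ (n + 2) * ((x ^ (n + 1) - y ^ (n + 1)) * rrSeq y a n)) := by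
      rw [rrSeq_add_two x a (n + 2), rrSeq_add_two x a (n + 1), rrSeq_add_two x a n,
        rrSeq_add_two y a (n + 2), rrSeq_add_two y a (n + 1), rrSeq_add_two y a n]; ring
    have hR := norm_one_add_pow_add_pow_succ_le hx hxR (n + 2)
    have hR0 : 0 ≤ 1 + R := (norm_nonneg _).trans hR
    have hsrc : ‖(x ^ (n + 2 + 1) - y ^ (n + 2 + 1)) * rrSeq y a (n + 2) +
        (x ^ (n + 1 + 1) - y ^ (n + 1 + 1)) * rrSeq y a (n + 1) -
        x ^ (n + 2) * ((x ^ (n + 1) - y ^ (n + 1)) * rrSeq y a n)‖ ≤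
        3 * ((n + 3) * ‖x - y‖ * (3 * r ^ (n + 4))) := by
      refine (norm_sub_le _ _).trans ?_
      rw [norm_mul (x ^ (n + 2)), norm_pow x, hx, one_pow, one_mul]
      have := norm_add_le_of_le (hf (n + 2) le_rfl) (hf (n + 1) (by omega))
      linarith [hf n (by omega)]
    have hmain : ‖(1 + x ^ (n + 2) + x ^ (n + 2 + 1)) * (rrSeq x a (n + 2) - rrSeq y a (n + 2)) -
        x ^ (2 * n + 3) * (rrSeq x a n - rrSeq y a n)‖ ≤
        3 * ‖x - y‖ * (n + 2) ^ 2 * r ^ (n + 4) := by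
      refine (norm_sub_le _ _).trans ?_
      rw [norm_mul, norm_mul, norm_pow x, hx, one_pow, one_mul]
      have h1 := ih n (by omega)
      have h2 : 3 * ‖x - y‖ * (n : ℝ) ^ 2 * r ^ n ≤ 3 * ‖x - y‖ * (n + 2) ^ 2 * r ^ n := by
        have := hp n
        gcongr
        linarith
      have h3 := ih (n + 2) (by omega)
      push_cast at h3
      calc _ ≤ (1 + R) * (3 * ‖x - y‖ * (n + 2) ^ 2 * r ^ (n + 2)) +
            3 * ‖x - y‖ * (n + 2) ^ 2 * r ^ n :=
            add_le_add (mul_le_mul hR h3 (norm_nonneg _) hR0) (h1.trans h2)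
        _ = 3 * ‖x - y‖ * (n + 2) ^ 2 * r ^ n * ((1 + R) * r ^ 2 + 1) := by ring
        _ = 3 * ‖x - y‖ * (n + 2) ^ 2 * r ^ (n + 4) := by rw [← hrR]; ring
    rw [e]
    refine (norm_add_le_of_le hmain hsrc).trans ?_
    -- The sources contribute `9 (n + 3)`, and the bound gains `3 ((n + 4)² - (n + 2)²) = 12 (n +
    -- 3)`.
    have h0 : 0 ≤ ‖x - y‖ * r ^ (n + 4) := mul_nonneg hδ (by linarith [hp (n + 4)])
    have h1 : 0 ≤ ‖x - y‖ * r ^ (n + 4) * n := mul_nonneg h0 (Nat.cast_nonneg n)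
    push_cast
    nlinarith

end Growth

/-! ### Approximants and the divergence criterion -/

theorem K_s_get? (x : ℂ) (n : ℕ) : (K x).s.get? n = some ⟨x ^ (n + 1), 1⟩ := rfl

theorem K_nums_dens (x : ℂ) (n : ℕ) :
    ((K x).nums n = rrSeq x 1 (n + 1) ∧ (K x).dens n = rrSeq x 0 (n + 1)) ∧
      ((K x).nums (n + 1) = rrSeq x 1 (n + 2) ∧ (K x).dens (n + 1) = rrSeq x 0 (n + 2)) := by
  induction n with
  | zero =>
    refine ⟨⟨?_, ?_⟩, ?_, ?_⟩
    · rw [GenContFract.zeroth_num_eq_h]; rfl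
    · rw [GenContFract.zeroth_den_eq_one]; rfl
    · rw [GenContFract.first_num_eq (K_s_get? x 0)]; simp [K, rrSeq]
    · rw [GenContFract.first_den_eq (K_s_get? x 0)]; simp [rrSeq]
  | succ n ih =>
    refine ⟨ih.2, ?_, ?_⟩
    · rw [GenContFract.nums_recurrence (K_s_get? x (n + 1)) ih.1.1 ih.2.1,
        rrSeq_add_two x 1 (n + 1)]
      ring
    · rw [GenContFract.dens_recurrence (K_s_get? x (n + 1)) ih.1.2 ih.2.2,
        rrSeq_add_two x 0 (n + 1)]
      ring

theorem approximant_K (x : ℂ) (n : ℕ) [Decidable (rrSeq x 0 (n + 1) = 0)] :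
    approximant (K x) n = if rrSeq x 0 (n + 1) = 0 then OnePoint.infty
      else ((rrSeq x 1 (n + 1) / rrSeq x 0 (n + 1) : ℂ) : OnePoint ℂ) := by
  unfold approximant
  rw [(K_nums_dens x n).1.1, (K_nums_dens x n).1.2]
  congr

/-- Clearing the denominator lets a limit be tested by the determinant, with no division left. -/
theorem eventually_norm_sub_le_of_tendsto_coe {x z : ℂ}
    (h : Tendsto (approximant (K x)) atTop (𝓝 (z : OnePoint ℂ))) {ε : ℝ} (hε : 0 < ε) :
    ∀ᶠ n in atTop, ‖rrSeq x 1 (n + 1) - z * rrSeq x 0 (n + 1)‖ ≤ ε * ‖rrSeq x 0 (n + 1)‖ := by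
  classical
  have ho : IsOpen ((fun w : ℂ => (w : OnePoint ℂ)) '' Metric.ball z ε) :=
    OnePoint.isOpenEmbedding_coe.isOpenMap _ Metric.isOpen_ball
  filter_upwards [h (ho.mem_nhds ⟨z, Metric.mem_ball_self hε, rfl⟩)] with n hn
  rw [Set.mem_preimage, approximant_K] at hn
  obtain ⟨w, hw, hwn⟩ := hn
  split_ifs at hwn with h0
  · exact absurd hwn (OnePoint.coe_ne_infty w)
  have hw' := OnePoint.coe_injective hwn
  have e : rrSeq x 1 (n + 1) - z * rrSeq x 0 (n + 1) = (w - z) * rrSeq x 0 (n + 1) := by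
    rw [hw']; field_simp
  rw [e, norm_mul]
  exact mul_le_mul_of_nonneg_right (mem_ball_iff_norm.1 hw).le (norm_nonneg _)

theorem eventually_norm_le_of_tendsto_infty {x : ℂ}
    (h : Tendsto (approximant (K x)) atTop (𝓝 OnePoint.infty)) {ε : ℝ} (hε : 0 < ε) :
    ∀ᶠ n in atTop, ‖rrSeq x 0 (n + 1)‖ ≤ ε * ‖rrSeq x 1 (n + 1)‖ := by
  classical
  have ho : IsOpen ((fun w : ℂ => (w : OnePoint ℂ)) '' Metric.closedBall 0 ε⁻¹)ᶜ :=
    OnePoint.isOpen_compl_image_coe.2 ⟨Metric.isClosed_closedBall, isCompact_closedBall _ _⟩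
  filter_upwards [h (ho.mem_nhds fun ⟨w, _, hw⟩ => OnePoint.coe_ne_infty w hw)] with n hn
  rw [Set.mem_preimage, approximant_K] at hn
  split_ifs at hn with h0
  · rw [h0, norm_zero]; positivity
  have h1 : ε⁻¹ < ‖rrSeq x 1 (n + 1) / rrSeq x 0 (n + 1)‖ := by
    by_contra! h2
    exact hn ⟨_, by simpa using h2, rfl⟩
  rw [norm_div, lt_div_iff₀ (norm_pos_iff.2 h0)] at h1
  calc ‖rrSeq x 0 (n + 1)‖ = ε * (ε⁻¹ * ‖rrSeq x 0 (n + 1)‖) := by field_simp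
    _ ≤ _ := mul_le_mul_of_nonneg_left h1.le hε.le

/-- If infinitely many pairs of consecutive numerators and denominators are bounded, then the
continued fraction diverges. -/
theorem diverges_of_frequently_norm_le {x : ℂ} (hx : ‖x‖ = 1) (B : ℝ)
    (h : ∃ᶠ n : ℕ in atTop, (‖rrSeq x 0 (n + 1)‖ ≤ B ∧ ‖rrSeq x 0 (n + 2)‖ ≤ B) ∧
      ‖rrSeq x 1 (n + 1)‖ ≤ B ∧ ‖rrSeq x 1 (n + 2)‖ ≤ B) : Diverges (K x) := by
  rintro ⟨L, hL⟩
  -- Chosen so that two products, each at most `ε * B * B`, add up to less than the determinant's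
  -- modulus 1.
  set ε : ℝ := 1 / (4 * (B ^ 2 + 1)) with hε
  have hε0 : 0 < ε := by positivity
  have hεB : 2 * (ε * (B * B)) < 1 := by
    have : ε * (4 * (B ^ 2 + 1)) = 1 := by rw [hε]; field_simp
    nlinarith
  have bound : ∀ a b c d : ℂ, ‖a‖ ≤ ε * ‖b‖ → ‖c‖ ≤ ε * ‖d‖ → ‖b‖ ≤ B → ‖d‖ ≤ B →
      ‖a * d - c * b‖ < 1 := by
    intro a b c d h1 h2 h3 h4
    have hB : 0 ≤ B := (norm_nonneg _).trans h3
    refine lt_of_le_of_lt (norm_sub_le _ _) (lt_of_le_of_lt ?_ hεB)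
    rw [norm_mul, norm_mul]
    have h5 : ‖a‖ * ‖d‖ ≤ ε * B * B :=
      mul_le_mul (h1.trans (mul_le_mul_of_nonneg_left h3 hε0.le)) h4 (norm_nonneg _) (by positivity)
    have h6 : ‖c‖ * ‖b‖ ≤ ε * B * B :=
      mul_le_mul (h2.trans (mul_le_mul_of_nonneg_left h4 hε0.le)) h3 (norm_nonneg _) (by positivity)
    linarith
  induction L using OnePoint.rec with
  | infty =>
    have h1 := eventually_norm_le_of_tendsto_infty hL hε0
    obtain ⟨n, ⟨⟨_, _⟩, h4, h5⟩, h2, h3⟩ :=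
      (h.and_eventually (h1.and ((tendsto_add_atTop_nat 1).eventually h1))).exists
    have := bound _ _ _ _ h2 h3 h4 h5
    refine this.ne ?_
    rw [← norm_det_rrSeq hx (n + 1)]
    congr 1; ring
  | coe z =>
    -- Replacing numerators `P` by `P - z Q` leaves the determinant unchanged, so no bound on `z` is
    -- needed.
    have h1 := eventually_norm_sub_le_of_tendsto_coe hL hε0
    obtain ⟨n, ⟨⟨h4, h5⟩, _⟩, h2, h3⟩ :=
      (h.and_eventually (h1.and ((tendsto_add_atTop_nat 1).eventually h1))).exists
    have := bound _ _ _ _ h2 h3 h4 h5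
    refine this.ne ?_
    rw [← norm_det_rrSeq hx (n + 1), ← norm_neg]
    congr 1; ring

/-! ### Convergents of an irrational number -/

section Convergents

variable {t : ℝ}

theorem exists_of_s_get? (ht : Irrational t) (n : ℕ) :
    ∃ k : ℕ, 1 ≤ k ∧ (GenContFract.of t).s.get? n = some ⟨1, k⟩ ∧ partialQuotient t n = k := by
  obtain ⟨gp, hgp⟩ : ∃ gp, (GenContFract.of t).s.get? n = some gp := by
    refine Option.ne_none_iff_exists'.1 fun h => ?_
    obtain ⟨q, hq⟩ := (GenContFract.terminates_iff_rat t).1 ⟨n, h⟩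
    exact ht ⟨q, hq.symm⟩
  obtain ⟨ha, z, hz⟩ := GenContFract.of_partNum_eq_one_and_exists_int_partDen_eq hgp
  have hb := GenContFract.partDen_eq_s_b hgp
  have h1 := GenContFract.of_one_le_get?_partDen hb
  rw [hz] at h1
  have h1' : 1 ≤ z := by exact_mod_cast h1
  lift z to ℕ using by omega
  refine ⟨z, by omega, ?_, ?_⟩
  · rw [hgp]
    congr 1
    cases gp
    simp_all
  · rw [partialQuotient, hb, Option.getD_some, hz]; simp

theorem one_le_partialQuotient (ht : Irrational t) (n : ℕ) : 1 ≤ partialQuotient t n := by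
  obtain ⟨k, hk, -, e⟩ := exists_of_s_get? ht n
  rw [e]; exact_mod_cast hk

theorem not_terminatedAt (ht : Irrational t) (n : ℕ) : ¬ (GenContFract.of t).TerminatedAt n := by
  obtain ⟨k, -, e, -⟩ := exists_of_s_get? ht n
  rw [GenContFract.terminatedAt_iff_s_none, e]; simp

theorem convergentDen_zero (t : ℝ) : convergentDen t 0 = 1 := GenContFract.zeroth_den_eq_one

theorem convergentDen_one (ht : Irrational t) : convergentDen t 1 = partialQuotient t 0 := by
  obtain ⟨k, -, e, e'⟩ := exists_of_s_get? ht 0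
  rw [convergentDen, GenContFract.first_den_eq e, e']

theorem convergentDen_add_two (ht : Irrational t) (n : ℕ) :
    convergentDen t (n + 2) =
      partialQuotient t (n + 1) * convergentDen t (n + 1) + convergentDen t n := by
  obtain ⟨k, -, e, e'⟩ := exists_of_s_get? ht (n + 1)
  rw [convergentDen, GenContFract.dens_recurrence e rfl rfl, e', one_mul]
  rfl

theorem exists_nat_eq_convergentDen (ht : Irrational t) (n : ℕ) :
    ∃ d : ℕ, convergentDen t n = d := by
  suffices h : (∃ d : ℕ, convergentDen t n = d) ∧ ∃ d : ℕ, convergentDen t (n + 1) = d from h.1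
  induction n with
  | zero =>
    obtain ⟨k, -, -, e⟩ := exists_of_s_get? ht 0
    exact ⟨⟨1, by simp [convergentDen_zero]⟩, k, by rw [convergentDen_one ht, e]⟩
  | succ n ih =>
    obtain ⟨⟨a, ha⟩, b, hb⟩ := ih
    obtain ⟨k, -, -, e⟩ := exists_of_s_get? ht (n + 1)
    exact ⟨⟨b, hb⟩, k * b + a, by rw [convergentDen_add_two ht, ha, hb, e]; push_cast; ring⟩

theorem exists_int_eq_nums (ht : Irrational t) (n : ℕ) :
    ∃ c : ℤ, (GenContFract.of t).nums n = c := by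
  suffices h : (∃ c : ℤ, (GenContFract.of t).nums n = c) ∧
    ∃ c : ℤ, (GenContFract.of t).nums (n + 1) = c from h.1
  induction n with
  | zero =>
    obtain ⟨k, -, e, -⟩ := exists_of_s_get? ht 0
    refine ⟨⟨⌊t⌋, ?_⟩, k * ⌊t⌋ + 1, ?_⟩
    · rw [GenContFract.zeroth_num_eq_h, GenContFract.of_h_eq_floor]
    · rw [GenContFract.first_num_eq e, GenContFract.of_h_eq_floor]; push_cast; ring
  | succ n ih =>
    obtain ⟨⟨a, ha⟩, b, hb⟩ := ih
    obtain ⟨k, -, e, -⟩ := exists_of_s_get? ht (n + 1)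
    exact ⟨⟨b, hb⟩, k * b + a, by rw [GenContFract.nums_recurrence e ha hb]; push_cast; ring⟩

theorem fib_le_convergentDen (ht : Irrational t) (n : ℕ) :
    (Nat.fib (n + 1) : ℝ) ≤ convergentDen t n :=
  GenContFract.succ_nth_fib_le_of_nth_den (.inr (not_terminatedAt ht _))

theorem convergentDen_pos (ht : Irrational t) (n : ℕ) : 0 < convergentDen t n :=
  lt_of_lt_of_le (by exact_mod_cast Nat.fib_pos.2 n.succ_pos) (fib_le_convergentDen ht n)

theorem tendsto_convergentDen (ht : Irrational t) : Tendsto (convergentDen t) atTop atTop := by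
  refine tendsto_atTop_mono' _ ?_ tendsto_natCast_atTop_atTop
  filter_upwards [eventually_ge_atTop 5] with n hn
  refine le_trans ?_ (fib_le_convergentDen ht n)
  exact_mod_cast (Nat.le_fib_self hn).trans Nat.fib_le_fib_succ

/-- The convergents of an irrational number are reduced fractions, and approximate it with an
error controlled by the next partial quotient. -/
theorem exists_convergent (ht : Irrational t) (n : ℕ) :
    ∃ (c : ℤ) (d : ℕ), d ≠ 0 ∧ convergentDen t n = d ∧ IsCoprime c (d : ℤ) ∧
      |t - c / d| ≤ 1 / (partialQuotient t n * (d : ℝ) ^ 2) := by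
  obtain ⟨c, hc⟩ := exists_int_eq_nums ht n
  obtain ⟨d, hd⟩ := exists_nat_eq_convergentDen ht n
  obtain ⟨c', hc'⟩ := exists_int_eq_nums ht (n + 1)
  obtain ⟨d', hd'⟩ := exists_nat_eq_convergentDen ht (n + 1)
  have hpos := convergentDen_pos ht n
  refine ⟨c, d, ?_, hd, ?_, ?_⟩
  · rintro rfl
    rw [hd] at hpos; simp at hpos
  -- The determinant `±1` of consecutive convergents is a Bézout relation.
  · have hdet := SimpContFract.determinant (s := SimpContFract.of t) (not_terminatedAt ht n)
    change (GenContFract.of t).nums n * convergentDen t (n + 1) - convergentDen t n *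
      (GenContFract.of t).nums (n + 1) = (-1) ^ (n + 1) at hdet
    rw [hc, hd, hc', hd'] at hdet
    have hdet' : c * (d' : ℤ) - d * c' = (-1) ^ (n + 1) := by exact_mod_cast hdet
    have hs : ((-1 : ℤ) ^ (n + 1)) * (-1) ^ (n + 1) = 1 := by
      rw [← mul_pow]; simp
    refine ⟨(-1) ^ (n + 1) * d', -((-1) ^ (n + 1) * c'), ?_⟩
    linear_combination (-1) ^ (n + 1) * hdet' + hs
  · obtain ⟨k, -, e, e'⟩ := exists_of_s_get? ht n
    have h := GenContFract.abs_sub_convergents_le' (GenContFract.partDen_eq_s_b e)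
    rw [GenContFract.conv_eq_num_div_den, hc] at h
    change |t - c / convergentDen t n| ≤ 1 / (k * convergentDen t n * convergentDen t n) at h
    rw [hd] at h
    rw [e']
    convert h using 2
    ring

end Convergents

/-! ### The set `T R` and divergence on `S R` -/

theorem one_lt_lam {R : ℝ} (hR : 0 < R) : 1 < lam R := by
  unfold lam
  have : 1 < √(1 + ((1 + R) / 2) ^ 2) := by
    rw [Real.lt_sqrt zero_le_one]; nlinarith
  linarith

theorem lam_sq (R : ℝ) : lam R ^ 2 = (1 + R) * lam R + 1 := by
  unfold lam
  have := Real.sq_sqrt (show 0 ≤ 1 + ((1 + R) / 2) ^ 2 by positivity)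
  linear_combination this

theorem mem_T_iff {R t : ℝ} (hR : 0 < R) : t ∈ T R ↔ t ∈ Set.Ioo 0 1 ∧ Irrational t ∧
    ∃ C : ℝ, 0 < C ∧
      ∃ᶠ n : ℕ in atTop, lam R ^ (convergentDen t n / 2) ≤ C * partialQuotient t n := by
  have hlam := one_lt_lam hR
  refine and_congr_right fun _ => and_congr_right fun ht => ?_
  have hpq : ∀ n, 0 < partialQuotient t n := fun n => by
    linarith [one_le_partialQuotient ht n]
  constructor
  · intro h
    obtain ⟨C, hC, hC'⟩ := ENNReal.lt_iff_exists_nnreal_btwn.1 h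
    -- The bound `C` may be zero; adding 1 makes the constant positive.
    refine ⟨C + 1, by positivity, (frequently_lt_of_liminf_lt (by isBoundedDefault) hC).mono
      fun n hn => ?_⟩
    have h1 := (ENNReal.ofReal_le_iff_le_toReal ENNReal.coe_ne_top).1 hn.le
    rw [ENNReal.coe_toReal, div_le_iff₀ (hpq n)] at h1
    linarith [hpq n]
  · rintro ⟨C, hC, h⟩
    refine lt_of_le_of_lt (liminf_le_of_frequently_le (a := ENNReal.ofReal C) (h.mono fun n hn => ?_)
      (by isBoundedDefault)) ENNReal.ofReal_lt_top
    exact ENNReal.ofReal_le_ofReal ((div_le_iff₀ (hpq n)).2 hn)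

theorem norm_expCircle (t : ℝ) : ‖expCircle t‖ = 1 := by
  rw [expCircle, Complex.norm_exp]
  simp

theorem norm_expCircle_sub_le (s t : ℝ) :
    ‖expCircle s - expCircle t‖ ≤ 2 * Real.pi * |s - t| := by
  have e : expCircle s - expCircle t =
      expCircle t * (Complex.exp (Complex.I * (2 * Real.pi * (s - t) : ℝ)) - 1) := by
    rw [expCircle, expCircle, mul_sub, ← Complex.exp_add, mul_one]
    congr 2
    push_cast; ring
  rw [e, norm_mul, norm_expCircle, one_mul]
  refine Real.norm_exp_I_mul_ofReal_sub_one_le.trans ?_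
  rw [Real.norm_eq_abs, abs_mul, abs_of_pos Real.two_pi_pos]

theorem isPrimitiveRoot_expCircle {c : ℤ} {d : ℕ} (hd : d ≠ 0) (h : IsCoprime c (d : ℤ)) :
    IsPrimitiveRoot (expCircle (c / d)) d := by
  have := Complex.isPrimitiveRoot_exp_of_isCoprime c d hd h
  rw [expCircle]
  exact_mod_cast this

/-- The continued fraction `K` diverges at every point of `S R`. -/
theorem diverges_of_mem_S {R : ℝ} (hR : 0 < R) {x : ℂ} (hx : x ∈ S R) : Diverges (K x) := by
  obtain ⟨⟨t, htT, rfl⟩, -, hxR⟩ := hx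
  obtain ⟨-, ht, C, hC, hfreq⟩ := (mem_T_iff hR).1 htT
  have hlam := one_lt_lam hR
  set r := √(lam R) with hr_def
  have hr2 : r ^ 2 = lam R := Real.sq_sqrt (by linarith)
  have hr : 1 ≤ r := Real.one_le_sqrt.2 hlam.le
  have hr4 : r ^ 4 = (1 + R) * r ^ 2 + 1 := by
    rw [show r ^ 4 = (r ^ 2) ^ 2 by ring, hr2, lam_sq]
  choose c d hd hdd hcd happrox using exists_convergent ht
  have hpow : ∀ n, lam R ^ (convergentDen t n / 2) = r ^ d n := fun n => by
    rw [hdd, hr_def, Real.sqrt_eq_rpow, ← Real.rpow_natCast, ← Real.rpow_mul (by linarith)]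
    congr 1; ring
  have hdt : Tendsto d atTop atTop := by
    have := tendsto_convergentDen ht
    rw [show convergentDen t = fun n => (d n : ℝ) from funext hdd] at this
    exact tendsto_natCast_atTop_iff.1 this
  have hδ : ∀ n, ‖expCircle t - expCircle (c n / d n)‖ ≤
      2 * Real.pi / (partialQuotient t n * (d n : ℝ) ^ 2) := fun n => by
    refine (norm_expCircle_sub_le _ _).trans ?_
    rw [div_eq_mul_one_div (2 * Real.pi)]
    exact mul_le_mul_of_nonneg_left (happrox n) Real.two_pi_pos.le
  -- The strict inequality defining the arc leaves room for the approximating roots of unity.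
  have hy : ∀ᶠ n in atTop, ‖expCircle (c n / d n) + 1‖ ≤ R := by
    have h1 : Tendsto (fun n => 2 * Real.pi / (d n : ℝ)) atTop (𝓝 0) :=
      tendsto_const_nhds.div_atTop (tendsto_natCast_atTop_atTop.comp hdt)
    filter_upwards [h1.eventually_lt_const (sub_pos.2 hxR)] with n hn
    have hdn : (1 : ℝ) ≤ d n := by exact_mod_cast Nat.one_le_iff_ne_zero.2 (hd n)
    have h2 : 2 * Real.pi / (partialQuotient t n * (d n : ℝ) ^ 2) ≤ 2 * Real.pi / d n := by
      have := one_le_partialQuotient ht n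
      refine div_le_div_of_nonneg_left Real.two_pi_pos.le (by linarith) ?_
      nlinarith
    have h3 := norm_sub_le (expCircle t + 1) (expCircle t - expCircle (c n / d n))
    rw [show expCircle t + 1 - (expCircle t - expCircle (c n / d n)) =
      expCircle (c n / d n) + 1 by ring] at h3
    linarith [hδ n]
  have key : ∀ n, ‖expCircle (c n / d n) + 1‖ ≤ R →
      lam R ^ (convergentDen t n / 2) ≤ C * partialQuotient t n → ∀ a : ℂ, a = 0 ∨ a = 1 →
      ∀ m, m = d n ∨ m = d n + 1 → ‖rrSeq (expCircle t) a m‖ ≤ 8 + 24 * Real.pi * C * r := by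
    intro n hyn hn a ha m hm
    have hdn : (1 : ℝ) ≤ d n := by exact_mod_cast Nat.one_le_iff_ne_zero.2 (hd n)
    have hroot : ‖rrSeq (expCircle (c n / d n)) a m‖ ≤ 8 := by
      have := norm_rrSeq_le_of_isPrimitiveRoot (isPrimitiveRoot_expCircle (hd n) (hcd n)) (hd n) ha
      rcases hm with rfl | rfl
      exacts [this.1, this.2]
    have hpert := norm_rrSeq_sub_le (norm_expCircle t) hxR.le (norm_expCircle (c n / d n)) hyn
      (a := a) (by rcases ha with rfl | rfl <;> simp) hr hr4 m
    have he := one_le_partialQuotient ht n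
    have hm2 : (m : ℝ) ^ 2 ≤ 4 * (d n : ℝ) ^ 2 := by
      have : (m : ℝ) ≤ 2 * d n := by
        rcases hm with rfl | rfl <;> push_cast <;> linarith
      nlinarith [Nat.cast_nonneg (α := ℝ) m]
    have hrm : r ^ m ≤ C * partialQuotient t n * r := by
      rw [hpow] at hn
      have : r ^ m ≤ r ^ (d n + 1) := pow_le_pow_right₀ hr (by omega)
      refine this.trans ?_
      rw [pow_succ]
      exact mul_le_mul_of_nonneg_right hn (by linarith)
    -- The partial quotient and `d²` cancel, leaving `3 · 2π · 4 · C · r`; the 4 comes from `m ≤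
    -- 2d`.
    have hsmall : 3 * ‖expCircle t - expCircle (c n / d n)‖ * m ^ 2 * r ^ m ≤
        24 * Real.pi * C * r := by
      calc _ ≤ 3 * (2 * Real.pi / (partialQuotient t n * (d n : ℝ) ^ 2)) * (4 * (d n : ℝ) ^ 2) *
            (C * partialQuotient t n * r) := by
            have := hδ n
            have := Real.pi_pos
            gcongr
        _ = _ := by field_simp; norm_num
    have h3 := norm_add_le (rrSeq (expCircle t) a m - rrSeq (expCircle (c n / d n)) a m)
      (rrSeq (expCircle (c n / d n)) a m)
    rw [sub_add_cancel] at h3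
    linarith
  refine diverges_of_frequently_norm_le (norm_expCircle t) (8 + 24 * Real.pi * C * r) ?_
  -- Shift by one because the criterion is stated at indices `n + 1` and `n + 2`.
  have hdt' : Tendsto (fun n => d n - 1) atTop atTop := (tendsto_sub_atTop_nat 1).comp hdt
  refine hdt'.frequently ((hfreq.and_eventually hy).mono fun n hn => ?_)
  have e1 : d n - 1 + 1 = d n := Nat.sub_add_cancel (Nat.one_le_iff_ne_zero.2 (hd n))
  have e2 : d n - 1 + 2 = d n + 1 := by omega
  rw [e1, e2]
  have k := key n hn.2 hn.1
  exact ⟨⟨k 0 (.inl rfl) _ (.inl rfl), k 0 (.inl rfl) _ (.inr rfl)⟩,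
    k 1 (.inr rfl) _ (.inl rfl), k 1 (.inr rfl) _ (.inr rfl)⟩

/-! ### Measure zero -/

/-- Exponential growth is far more than needed: a partial quotient at least linear in `d` already
gives an error of order `1 / d³`, and almost no real number admits an exponent above 2. -/
theorem liouvilleWith_of_mem_T {R t : ℝ} (hR : 0 < R) (h : t ∈ T R) : LiouvilleWith 3 t := by
  obtain ⟨-, ht, C, hC, hfreq⟩ := (mem_T_iff hR).1 h
  have hlam := one_lt_lam hR
  choose c d hd hdd hcd happrox using exists_convergent ht
  have hdt : Tendsto d atTop atTop := by
    have := tendsto_convergentDen ht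
    rw [show convergentDen t = fun n => (d n : ℝ) from funext hdd] at this
    exact tendsto_natCast_atTop_iff.1 this
  set β := Real.log (lam R) / 2 with hβ
  have hβ0 : 0 < β := half_pos (Real.log_pos hlam)
  refine ⟨C / β + 1, hdt.frequently (hfreq.mono fun n hn => ⟨c n, ?_, ?_⟩)⟩
  · exact_mod_cast ht.ne_rat (c n / d n)
  have hdn : (0 : ℝ) < d n := by exact_mod_cast Nat.pos_of_ne_zero (hd n)
  have he : 0 < partialQuotient t n := by linarith [one_le_partialQuotient ht n]
  have h1 : β * d n ≤ C * partialQuotient t n := by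
    refine le_trans ?_ hn
    rw [Real.rpow_def_of_pos (by linarith), hdd]
    have := Real.add_one_le_exp (Real.log (lam R) * (d n / 2))
    rw [hβ]
    linarith
  have h2 : (1 : ℝ) / (partialQuotient t n * (d n : ℝ) ^ 2) ≤ C / β / (d n : ℝ) ^ 3 := by
    rw [div_div, div_le_div_iff₀ (by positivity) (by positivity)]
    nlinarith [mul_le_mul_of_nonneg_right h1 (sq_nonneg (d n : ℝ))]
  refine lt_of_le_of_lt ((happrox n).trans h2) ?_
  rw [show ((d n : ℝ) ^ (3 : ℝ)) = (d n : ℝ) ^ 3 by exact_mod_cast Real.rpow_natCast (d n : ℝ) 3]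
  gcongr
  linarith

theorem volume_T {R : ℝ} (hR : 0 < R) : volume (T R) = 0 := by
  refine measure_mono_null (fun t ht => ?_) (ae_iff.1 ae_not_liouvilleWith)
  simp only [Set.mem_ofPred_eq, not_forall, not_not]
  exact ⟨3, by norm_num, liouvilleWith_of_mem_T hR ht⟩

theorem hausdorffMeasure_S {R : ℝ} (hR : 0 < R) : Measure.hausdorffMeasure 1 (S R) = 0 := by
  have hL : LipschitzWith ⟨2 * Real.pi, Real.two_pi_pos.le⟩ expCircle :=
    LipschitzWith.of_dist_le_mul fun s t => by
      rw [dist_eq_norm, Real.dist_eq]; exact norm_expCircle_sub_le s t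
  refine measure_mono_null Set.inter_subset_left (le_antisymm ?_ bot_le)
  refine (hL.hausdorffMeasure_image_le zero_le_one (T R)).trans ?_
  rw [hausdorffMeasure_real, volume_T hR, mul_zero]

/-! ### Numbers with prescribed partial quotients -/

theorem exists_partial_continued_fraction (n : ℕ) (a : ℕ → ℕ) (ha : ∀ k, 1 ≤ a k) :
    ∃ τ : ℕ → ℝ, (∀ k, τ k ∈ Set.Icc (0 : ℝ) 1) ∧ ∀ k < n, τ k * (a k + τ (k + 1)) = 1 := by
  induction n generalizing a with
  | zero => exact ⟨0, by simp⟩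
  | succ n ih =>
    obtain ⟨g, hg, hg'⟩ := ih (fun k => a (k + 1)) fun k => ha _
    have h1 : (1 : ℝ) ≤ a 0 + g 0 := by
      have : (1 : ℝ) ≤ a 0 := by exact_mod_cast ha 0
      linarith [(hg 0).1]
    refine ⟨fun k => Nat.casesOn k (1 / (a 0 + g 0)) g, ?_, ?_⟩
    · rintro (_ | k)
      · exact ⟨div_nonneg zero_le_one (by linarith), (div_le_one (by linarith)).2 h1⟩
      · exact hg k
    · rintro (_ | k) hk
      · exact one_div_mul_cancel (by linarith)
      · exact hg' k (by omega)

/-- Every sequence of positive integers is the sequence of partial quotients of an irrational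
number; `τ n` are its successive remainders. -/
theorem exists_partialQuotient_eq (a : ℕ → ℕ) (ha : ∀ k, 1 ≤ a k) :
    ∃ τ : ℕ → ℝ, (∀ k, τ k ∈ Set.Ioo (0 : ℝ) 1) ∧ (∀ k, τ k * (a k + τ (k + 1)) = 1) ∧
      Irrational (τ 0) ∧ ∀ n, partialQuotient (τ 0) n = a n := by
  -- Compactness of `[0, 1]^ℕ`: the finite truncations of the system for the remainders define
  -- nested nonempty closed sets.
  set A : ℕ → Set (ℕ → ℝ) := fun n => {τ | (∀ k, τ k ∈ Set.Icc (0 : ℝ) 1) ∧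
    ∀ k < n, τ k * (a k + τ (k + 1)) = 1} with hA
  have hclosed : ∀ n, IsClosed (A n) := fun n => by
    refine IsClosed.inter (s₁ := {τ : ℕ → ℝ | ∀ k, τ k ∈ Set.Icc (0 : ℝ) 1})
      (s₂ := {τ : ℕ → ℝ | ∀ k < n, τ k * (a k + τ (k + 1)) = 1}) ?_ ?_
    · have e : {τ : ℕ → ℝ | ∀ k, τ k ∈ Set.Icc (0 : ℝ) 1} =
          ⋂ k, {τ | τ k ∈ Set.Icc (0 : ℝ) 1} := by ext; simp
      rw [e]
      exact isClosed_iInter fun k => isClosed_Icc.preimage (continuous_apply k)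
    · have e : {τ : ℕ → ℝ | ∀ k < n, τ k * (a k + τ (k + 1)) = 1} =
          ⋂ k, ⋂ _ : k < n, {τ : ℕ → ℝ | τ k * (a k + τ (k + 1)) = (1 : ℝ)} := by ext; simp
      rw [e]
      exact isClosed_iInter fun k => isClosed_iInter fun _ =>
        isClosed_eq (by fun_prop) continuous_const
  have hcompact : IsCompact (A 0) :=
    (isCompact_univ_pi fun _ : ℕ => isCompact_Icc (a := (0 : ℝ)) (b := 1)).of_isClosed_subset
      (hclosed 0) fun τ hτ k _ => hτ.1 k
  obtain ⟨τ, hτ⟩ := IsCompact.nonempty_iInter_of_sequence_nonempty_isCompact_isClosed A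
    (fun n τ hτ => ⟨hτ.1, fun k hk => hτ.2 k (by omega)⟩)
    (fun n => exists_partial_continued_fraction n a ha) hcompact hclosed
  rw [Set.mem_iInter] at hτ
  have hrec : ∀ k, τ k * (a k + τ (k + 1)) = 1 := fun k => (hτ (k + 1)).2 k k.lt_succ_self
  have ha' : ∀ k, (1 : ℝ) ≤ a k := fun k => by exact_mod_cast ha k
  have hpos : ∀ k, 0 < τ k := fun k => by
    refine lt_of_le_of_ne ((hτ 0).1 k).1 fun h => ?_
    have := hrec k
    rw [← h, zero_mul] at this
    exact zero_ne_one this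
  have hlt : ∀ k, τ k < 1 := fun k => by
    by_contra! h
    have := hrec k
    nlinarith [hpos (k + 1), ha' k]
  have hinv : ∀ k, (τ k)⁻¹ = a k + τ (k + 1) := fun k =>
    inv_eq_of_mul_eq_one_right (hrec k)
  -- General `v` is needed: the expansion continues with `(τ k)⁻¹`, which has integer part `a k` and
  -- fractional part `τ (k + 1)`.
  have hs : ∀ n k v, Int.fract v = τ k →
      (GenContFract.of v).s.get? n = some ⟨1, (a (k + n) : ℝ)⟩ := by
    intro n
    induction n with
    | zero =>
      intro k v hv
      have h := GenContFract.of_s_head (v := v) (by rw [hv]; exact (hpos k).ne')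
      rw [hv, hinv, Int.floor_natCast_add,
        Int.floor_eq_zero_iff.2 ⟨(hpos _).le, hlt _⟩] at h
      simpa using! h
    | succ n ih =>
      intro k v hv
      rw [GenContFract.of_s_succ, hv, ih (k + 1)]
      · rw [Nat.add_right_comm, Nat.add_assoc]
      · rw [hinv, Int.fract_natCast_add, Int.fract_eq_self.2 ⟨(hpos _).le, hlt _⟩]
  have hs0 : ∀ n, (GenContFract.of (τ 0)).s.get? n = some ⟨1, (a n : ℝ)⟩ := fun n => by
    have := hs n 0 (τ 0) (Int.fract_eq_self.2 ⟨(hpos _).le, hlt _⟩)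
    rwa [zero_add] at this
  refine ⟨τ, fun k => ⟨hpos k, hlt k⟩, hrec, ?_, fun n => ?_⟩
  · rintro ⟨q, hq⟩
    obtain ⟨n, hn⟩ := (GenContFract.terminates_iff_rat (τ 0)).2 ⟨q, hq.symm⟩
    rw [Stream'.Seq.TerminatedAt, hs0] at hn
    exact Option.some_ne_none _ hn
  · rw [partialQuotient, GenContFract.partDen_eq_s_b (hs0 n), Option.getD_some]

/-- The consecutive denominators `(dₙ, dₙ₊₁)` for partial quotients that depend on the preceding
denominator, `e₁ = 2` and `eₙ₊₂ = g n dₙ₊₁`. -/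
def denPair (g : ℕ → ℕ → ℕ) : ℕ → ℕ × ℕ
  | 0 => (1, 2)
  | n + 1 => ((denPair g n).2, g n (denPair g n).2 * (denPair g n).2 + (denPair g n).1)

/-- With first partial quotient 2 and the next at least `k`, `t = 1 / (2 + τ 1)` is near `1 / 2`, so
`expCircle t` is near `-1`, the centre of the arc. -/
theorem exists_partialQuotient_eq_of_convergentDen (g : ℕ → ℕ → ℕ) {k : ℕ} (hk : 1 ≤ k)
    (hg : ∀ n d, k ≤ g n d) :
    ∃ t ∈ Set.Ioo (0 : ℝ) 1, Irrational t ∧ |t - 1 / 2| ≤ 1 / k ∧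
      ∀ n, ∃ d : ℕ, convergentDen t (n + 1) = d ∧ partialQuotient t (n + 1) = g n d := by
  obtain ⟨τ, hτ, hrec, hirr, hpq⟩ := exists_partialQuotient_eq
    (fun n => Nat.casesOn n 2 fun n => g n (denPair g n).2) (by
      rintro (_ | n)
      · simp
      · exact hk.trans (hg _ _))
  have hden : ∀ n, convergentDen (τ 0) n = (denPair g n).1 ∧
      convergentDen (τ 0) (n + 1) = (denPair g n).2 := by
    intro n
    induction n with
    | zero =>
      exact ⟨by simp [convergentDen_zero, denPair],
        by rw [convergentDen_one hirr, hpq]; simp [denPair]⟩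
    | succ n ih =>
      refine ⟨ih.2, ?_⟩
      rw [convergentDen_add_two hirr, hpq, ih.1, ih.2]
      simp [denPair]
  refine ⟨τ 0, hτ 0, hirr, ?_, fun n => ⟨_, (hden n).2, hpq _⟩⟩
  have h0 : τ 0 * (2 + τ 1) = 1 := by simpa using hrec 0
  have h1 : τ 1 * (g 0 (denPair g 0).2 + τ 2) = 1 := by simpa using hrec 1
  have hk0 : (0 : ℝ) < k := by exact_mod_cast hk
  have h2 : τ 1 ≤ 1 / k := by
    rw [le_div_iff₀ hk0]
    have : (k : ℝ) ≤ g 0 (denPair g 0).2 := by exact_mod_cast hg _ _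
    nlinarith [(hτ 1).1, (hτ 2).1]
  refine le_trans (abs_le.2 ⟨?_, ?_⟩) h2 <;> nlinarith [(hτ 0).1, (hτ 1).1, (hτ 0).2]

/-! ### Uncountability and the proper inclusion -/

theorem expCircle_one_half : expCircle (1 / 2) = -1 := by
  rw [expCircle, ← Complex.exp_pi_mul_I]
  congr 1
  push_cast; ring

theorem injOn_expCircle : Set.InjOn expCircle (Set.Ioo 0 1) := by
  intro s hs t ht h
  obtain ⟨n, hn⟩ := Complex.exp_eq_exp_iff_exists_int.1 h
  have h1 : (s : ℂ) = t + n := by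
    have hne := Complex.two_pi_I_ne_zero
    refine mul_left_cancel₀ hne ?_
    rw [hn]; ring
  have h2 : s = t + n := by exact_mod_cast h1
  have h3 : n = 0 := by
    have l : (-1 : ℝ) < n := by linarith [hs.1, ht.2]
    have u : (n : ℝ) < 1 := by linarith [hs.2, ht.1]
    have l' : -1 < n := by exact_mod_cast l
    have u' : n < 1 := by exact_mod_cast u
    omega
  rw [h2, h3]; simp

/-- The constant `k` keeps the point in the arc, while the free sequence `ε` encodes subsets of `ℕ`
for uncountability; `ε = 0` gives the witness of properness. -/
theorem exists_mem_T {R : ℝ} (hR : 0 < R) : ∃ k : ℕ, ∀ ε : ℕ → ℕ, ∃ t ∈ T R,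
    expCircle t ∈ S R ∧ ∀ n, partialQuotient t (n + 1) =
      ⌈lam R ^ (convergentDen t (n + 1) / 2)⌉₊ + k + ε n := by
  obtain ⟨k, hk⟩ := exists_nat_gt (max 1 (2 * Real.pi / R))
  have hk1 : 1 ≤ k := by exact_mod_cast ((le_max_left _ _).trans_lt hk).le
  refine ⟨k, fun ε => ?_⟩
  obtain ⟨t, ht, hirr, hhalf, hpq⟩ := exists_partialQuotient_eq_of_convergentDen
    (fun n d => ⌈lam R ^ ((d : ℝ) / 2)⌉₊ + k + ε n) hk1 fun n d => by omega
  have hpq' : ∀ n, partialQuotient t (n + 1) =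
      ⌈lam R ^ (convergentDen t (n + 1) / 2)⌉₊ + k + ε n := fun n => by
    obtain ⟨d, hd, hd'⟩ := hpq n
    rw [hd', hd]; push_cast; rfl
  have hT : t ∈ T R := by
    refine (mem_T_iff hR).2 ⟨ht, hirr, 1, one_pos, Eventually.frequently ?_⟩
    filter_upwards [eventually_ge_atTop 1] with n hn
    obtain ⟨n, rfl⟩ := Nat.exists_eq_add_of_le' hn
    rw [one_mul, hpq']
    have := Nat.le_ceil (lam R ^ (convergentDen t (n + 1) / 2))
    have : (0 : ℝ) ≤ k + ε n := by positivity
    linarith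
  refine ⟨t, hT, ⟨⟨t, hT, rfl⟩, norm_expCircle t, ?_⟩, hpq'⟩
  have h := norm_expCircle_sub_le t (1 / 2)
  rw [expCircle_one_half, sub_neg_eq_add] at h
  have hk0 : (0 : ℝ) < k := by exact_mod_cast hk1
  have h2 : 2 * Real.pi * (1 / k) < R := by
    have := (div_lt_iff₀ hR).1 ((le_max_right _ _).trans_lt hk)
    rw [mul_one_div, div_lt_iff₀ hk0]
    linarith
  exact (h.trans (mul_le_mul_of_nonneg_left hhalf Real.two_pi_pos.le)).trans_lt h2

theorem not_countable_S {R : ℝ} (hR : 0 < R) : ¬ (S R).Countable := by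
  intro hS
  obtain ⟨k, hk⟩ := exists_mem_T hR
  choose t htT htS ht using fun A : Set ℕ => hk (Set.indicator A 1)
  have hinj : Function.Injective t := by
    intro A B h
    ext n
    have h1 := ht A n
    rw [h, ht B n, add_right_inj, Nat.cast_inj] at h1
    by_cases hA : n ∈ A <;> by_cases hB : n ∈ B <;> simp [hA, hB] at h1 ⊢
  have hc := hS.to_subtype
  have hF : Function.Injective fun A => (⟨expCircle (t A), htS A⟩ : S R) := fun A B h =>
    hinj (injOn_expCircle (htT A).1 (htT B).1 (Subtype.mk_eq_mk.1 h))
  have := hF.countable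
  obtain ⟨f, hf⟩ := exists_injective_nat (Set ℕ)
  exact Function.cantor_injective f hf

/-- At `R = √5 - 1` one has `lam R = φ ^ 2`, which explains the threshold. -/
theorem sqrt_lam_lt_goldenRatio {R : ℝ} (hR : 0 < R) (h : R < √5 - 1) :
    √(lam R) < Real.goldenRatio := by
  rw [Real.sqrt_lt' Real.goldenRatio_pos]
  have h5 : √5 ^ 2 = 5 := Real.sq_sqrt (by norm_num)
  have hφ : Real.goldenRatio ^ 2 = √5 / 2 + 3 / 2 := by
    unfold Real.goldenRatio; linear_combination h5 / 4
  have h3 : √(1 + ((1 + R) / 2) ^ 2) < 3 / 2 := by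
    rw [Real.sqrt_lt' (by norm_num)]
    nlinarith [Real.sqrt_nonneg 5]
  rw [hφ, lam]
  linarith

theorem lam_rpow_half {R : ℝ} (hR : 0 < R) (x : ℝ) : lam R ^ (x / 2) = √(lam R) ^ x := by
  rw [Real.sqrt_eq_rpow, ← Real.rpow_mul (zero_lt_one.trans (one_lt_lam hR)).le]
  congr 1; ring

theorem bowmanMcLaughlin_ssubset_S {R : ℝ} (hR : 0 < R) (h : R < √5 - 1) :
    expCircle '' bowmanMcLaughlin ∩ M R ⊂ S R := by
  have hlt := sqrt_lam_lt_goldenRatio hR h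
  have hr : 1 ≤ √(lam R) := Real.one_le_sqrt.2 (one_lt_lam hR).le
  refine Set.ssubset_iff_exists.2 ⟨?_, ?_⟩
  · rintro _ ⟨⟨t, ⟨ht, hirr, hf⟩, rfl⟩, hM⟩
    refine ⟨⟨t, (mem_T_iff hR).2 ⟨ht, hirr, 1, one_pos, hf.mono fun n hn => ?_⟩, rfl⟩, hM⟩
    rw [one_mul, lam_rpow_half hR]
    exact (Real.rpow_le_rpow (by linarith) hlt.le (convergentDen_pos hirr n).le).trans hn
  · obtain ⟨k, hk'⟩ := exists_mem_T hR
    obtain ⟨t, htT, htS, hk⟩ := hk' 0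
    refine ⟨_, htS, ?_⟩
    rintro ⟨⟨s, ⟨hs, hirr, hf⟩, hst⟩, -⟩
    obtain rfl := injOn_expCircle hs htT.1 hst
    refine hf ?_
    set ρ := Real.goldenRatio / √(lam R) with hρ
    have hρ1 : 1 < ρ := (one_lt_div (by linarith)).2 hlt
    have hlim : Tendsto (fun n => ρ ^ convergentDen s n) atTop atTop :=
      (tendsto_rpow_atTop_of_base_gt_one ρ hρ1).comp (tendsto_convergentDen hirr)
    -- With `u = √(lam R) ^ d ≥ 1`, the partial quotient is at most `u + 1 + k ≤ (k + 2) u < ρ ^ d u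
    -- = φ ^ d`.
    filter_upwards [hlim.eventually_gt_atTop (k + 2 : ℝ), eventually_ge_atTop 1] with n hn hn1
    obtain ⟨n, rfl⟩ := Nat.exists_eq_add_of_le' hn1
    rw [not_le, hk, lam_rpow_half hR]
    have h0 := (convergentDen_pos hirr (n + 1)).le
    have h1 : 1 ≤ √(lam R) ^ convergentDen s (n + 1) := Real.one_le_rpow hr h0
    have h2 : Real.goldenRatio ^ convergentDen s (n + 1) =
        ρ ^ convergentDen s (n + 1) * √(lam R) ^ convergentDen s (n + 1) := by
      rw [← Real.mul_rpow (by positivity) (by linarith), hρ, div_mul_cancel₀ _ (by linarith)]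
    have h3 := (Nat.ceil_lt_add_one (zero_le_one.trans h1)).le
    rw [h2]
    simp only [Pi.zero_apply, Nat.cast_zero, add_zero]
    nlinarith [Nat.cast_nonneg (α := ℝ) k]

end RogersRamanujan

end

theorem theorem3 (R : ℝ) (hR : 0 < R) :
    ¬ (RogersRamanujan.S R).Countable ∧
    MeasureTheory.Measure.hausdorffMeasure 1 (RogersRamanujan.S R) = 0 ∧
    (∀ x ∈ RogersRamanujan.S R, RogersRamanujan.Diverges (RogersRamanujan.K x)) ∧
    (R < √5 - 1 →
      RogersRamanujan.expCircle '' RogersRamanujan.bowmanMcLaughlin ∩ RogersRamanujan.M R ⊂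
        RogersRamanujan.S R) :=
  ⟨RogersRamanujan.not_countable_S hR, RogersRamanujan.hausdorffMeasure_S hR,
    fun _ hx => RogersRamanujan.diverges_of_mem_S hR hx,
    RogersRamanujan.bowmanMcLaughlin_ssubset_S hR⟩
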